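/- Let $\xi\in\mathbb N$ be a failure level, $\mathscr X=\{0,1,\dots,\xi\}$ the set of deterioration levels, and $\mathscr S=[0,\bar s]$ with $0<\bar s<\infty$ the set of production rates. Let $f:\mathscr S\to\mathbb R_+$ and $r:\mathscr S\to\mathbb R$ be continuous and (weakly) increasing with $f(0)=0$ and $r(0)\le 0$, and let $c_m:\mathscr X\to\mathbb R_+$ be (weakly) increasing and convex. Let $\lambda\ge 0$. Time is indexed backwards: $k$ denotes the time remaining until planned maintenance. An admissible policy $u$ chooses, in a measurable and non-anticipating way (that is, as a function of the remaining time $k$, the current deterioration level and the number and epochs of the past increments), a production rate $S_k\in\mathscr S$, with $S_k=0$ whenever the system has failed, i.e. is at level $\xi$. Under $u$ the deterioration level $X_k$ increases by one at the jumps of a point process whose intensity, when $k$ time units remain, is $\lambda f(S_k)$. For $x\in\mathscr X$ and $t\ge 0$ put $$J^u_\lambda(x,t)=\mathbb E_u\Big[\int_0^t r(S_k)\,dk-c_m(X_0)\ \Big|\ X_t=x\Big],\qquad J^*_\lambda(x,t)=\sup_u J^u_\lambda(x,t),$$ where the supremum is over all admissible policies. Then for every $t\ge 0$ and every $\lambda\ge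 0$ the optimal expected profit $J^*_\lambda(x,t)$ is concave in $x$ on $\mathscr X$, i.e. $$J^*_\lambda(x+2,t)-J^*_\lambda(x+1,t)\le J^*_\lambda(x+1,t)-J^*_\lambda(x,t)\qquad\text{for all } x \text{ with } 0\le x\le \xi-2 .$$ -/

import Mathlib

/-!
A production system with deterioration levels `0, 1, …, ξ`. Time is indexed backwards: `k` denotes
the time that remains until the planned maintenance moment, so it runs from `t` down to `0`.
-/

noncomputable section

namespace CBP

open MeasureTheory ProbabilityTheory

/-- The primitives of the model: failure level `ξ`, maximal production rate `sbar`, deterioration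
function `f` and revenue function `r` on `[0, sbar]`, and maintenance cost `c` on `{0, …, ξ}`
(values elsewhere are never used). -/
structure Model where
  ξ : ℕ
  sbar : ℝ
  f : ℝ → ℝ
  r : ℝ → ℝ
  c : ℕ → ℝ

/-- Discrete convexity of `g` on the levels `{0, …, ξ}`: its increments are increasing. -/
def ConvexOnLevels (ξ : ℕ) (g : ℕ → ℝ) : Prop :=
  ∀ x, x + 2 ≤ ξ → g (x + 1) - g x ≤ g (x + 2) - g (x + 1)

/-- Discrete concavity of `g` on the levels `{0, …, ξ}`: its increments are decreasing. -/
def ConcaveOnLevels (ξ : ℕ) (g : ℕ → ℝ) : Prop :=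
  ∀ x, x + 2 ≤ ξ → g (x + 2) - g (x + 1) ≤ g (x + 1) - g x

/-- The standing assumptions on the primitives. -/
structure Model.Assumptions (M : Model) : Prop where
  sbar_pos : 0 < M.sbar
  f_cont : ContinuousOn M.f (Set.Icc 0 M.sbar)
  f_mono : MonotoneOn M.f (Set.Icc 0 M.sbar)
  f_zero : M.f 0 = 0
  r_cont : ContinuousOn M.r (Set.Icc 0 M.sbar)
  r_mono : MonotoneOn M.r (Set.Icc 0 M.sbar)
  r_zero : M.r 0 ≤ 0
  c_nonneg : ∀ x ≤ M.ξ, 0 ≤ M.c x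
  c_mono : MonotoneOn M.c (Set.Iic M.ξ)
  c_convex : ConvexOnLevels M.ξ M.c

/-- An admissible non-anticipating production policy. The production rate
`rate y n h k` in force when `k` time units remain may depend on the current level `y` and on the
whole observed history: the number `n` of increments observed so far and the remaining times
`h 0 > h 1 > … > h (n - 1)` at which they occurred. A failed system is turned off. -/
structure Policy (M : Model) where
  rate : ℕ → (n : ℕ) → (Fin n → ℝ) → ℝ → ℝ
  measurable_rate : ∀ y n, Measurable fun p : (Fin n → ℝ) × ℝ => rate y n p.1 p.2
  rate_mem : ∀ y n h k, rate y n h k ∈ Set.Icc 0 M.sbar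
  off : ∀ n h k, rate M.ξ n h k = 0

/-- The remaining time at which the first increment after `k₀` occurs, if increments occur with
intensity `a k` when `k` time units remain: the first moment (the largest `k ∈ [0, k₀]`) at which
the cumulative intensity since `k₀` reaches the threshold `e`. The value `-1` means that there is no
further increment before maintenance. -/
def nextEpoch (a : ℝ → ℝ) (e k₀ : ℝ) : ℝ :=
  open Classical in
  if ∃ k ∈ Set.Icc 0 k₀, e ≤ ∫ κ in k..k₀, a κ then
    sSup {k | k ∈ Set.Icc 0 k₀ ∧ e ≤ ∫ κ in k..k₀, a κ}
  else -1

/-- The most recent epoch in a history, or the starting time `t` if the history is empty. -/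
def lastEpoch (t : ℝ) : {n : ℕ} → (Fin n → ℝ) → ℝ
  | 0, _ => t
  | n + 1, h => h (Fin.last n)

/-- Sample space: one threshold for each level. -/
abbrev Clocks : Type := ℕ → ℝ

/-- Under `clockLaw` the thresholds are independent and exponential with mean `1`; hence, given the
history, the next increment of the process below has exactly the prescribed intensity. -/
def clockLaw : Measure Clocks := Measure.infinitePi fun _ : ℕ => expMeasure 1

section Dynamics

variable (M : Model) (lam : ℝ) (u : Policy M) (x : ℕ) (t : ℝ) (e : Clocks)

/-- The remaining times of the first `n` increments of the deterioration process that starts at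
level `x` with `t` time units remaining and whose intensity is the base rate `lam` times
`f` of the current production rate. -/
def epochs : (n : ℕ) → (Fin n → ℝ)
  | 0 => Fin.elim0
  | n + 1 =>
      Fin.snoc (α := fun _ => ℝ) (epochs n)
        (nextEpoch (fun κ => lam * M.f (u.rate (x + n) n (epochs n) κ)) (e (x + n))
          (lastEpoch t (epochs n)))

/-- Number of increments that have occurred when `k` time units remain. There are at most `ξ - x` of
them: from the failure level on the system is off and the intensity is `lam * f 0 = 0`. -/
def numIncrements (k : ℝ) : ℕ :=
  ((Finset.range (M.ξ - x)).filter
    fun n => k ≤ epochs M lam u x t e (n + 1) (Fin.last n)).card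

/-- The deterioration level `X_k` when `k` time units remain. -/
def level (k : ℝ) : ℕ := x + numIncrements M lam u x t e k

/-- The production rate in force when `k` time units remain. -/
def productionRate (k : ℝ) : ℝ :=
  u.rate (level M lam u x t e k) (numIncrements M lam u x t e k)
    (epochs M lam u x t e (numIncrements M lam u x t e k)) k

/-- The expected profit of policy `u` from level `x` with `t` time units remaining: expected
accumulated revenue minus expected cost at the maintenance moment. -/
def profit : ℝ :=
  ∫ e, ((∫ k in (0 : ℝ)..t, M.r (productionRate M lam u x t e k))
    - M.c (level M lam u x t e 0)) ∂clockLaw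

end Dynamics

/-- The optimal expected profit `J*_lam(x, t)`. -/
def optimalProfit (M : Model) (lam : ℝ) (x : ℕ) (t : ℝ) : ℝ :=
  ⨆ u : Policy M, profit M lam u x t

end CBP

end

noncomputable section

namespace CBP

open MeasureTheory ProbabilityTheory Set
open scoped NNReal ENNReal

/-- Net revenue rate of producing at rate `s` if an increment costs `d`. -/
def netRate (M : Model) (lam d s : ℝ) : ℝ := M.r s - lam * M.f s * d

/-- The production rates that maximize the net revenue rate. -/
def optimalRates (M : Model) (lam d : ℝ) : Set ℝ :=
  {s ∈ Icc 0 M.sbar | ∀ s' ∈ Icc 0 M.sbar, netRate M lam d s' ≤ netRate M lam d s}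

/-- The smallest production rate that maximizes the net revenue rate. -/
def optRate (M : Model) (lam d : ℝ) : ℝ := sInf (optimalRates M lam d)

/-- The maximal net revenue rate if an increment costs `d`. -/
def hamiltonian (M : Model) (lam d : ℝ) : ℝ := netRate M lam d (optRate M lam d)

section Hamiltonian

variable {M : Model} (hM : M.Assumptions) {lam : ℝ} (hlam : 0 ≤ lam)
include hM

lemma Model.Assumptions.zero_mem : (0 : ℝ) ∈ Icc 0 M.sbar := ⟨le_rfl, hM.sbar_pos.le⟩

lemma Model.Assumptions.f_nonneg {s : ℝ} (hs : s ∈ Icc 0 M.sbar) : 0 ≤ M.f s := by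
  rw [← hM.f_zero]
  exact hM.f_mono hM.zero_mem hs hs.1

lemma Model.Assumptions.f_le {s : ℝ} (hs : s ∈ Icc 0 M.sbar) : M.f s ≤ M.f M.sbar :=
  hM.f_mono hs ⟨hM.sbar_pos.le, le_rfl⟩ hs.2

lemma optRate_mem_optimalRates (lam d : ℝ) : optRate M lam d ∈ optimalRates M lam d := by
  have hcont : ContinuousOn (netRate M lam d) (Icc 0 M.sbar) :=
    hM.r_cont.sub ((continuousOn_const.mul hM.f_cont).mul continuousOn_const)
  obtain ⟨s₀, hs₀, hmax⟩ := isCompact_Icc.exists_isMaxOn ⟨0, hM.zero_mem⟩ hcont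
  have hne : (optimalRates M lam d).Nonempty := ⟨s₀, hs₀, fun s' hs' => hmax hs'⟩
  refine IsCompact.sInf_mem ?_ hne
  have heq : optimalRates M lam d
      = Icc 0 M.sbar ∩ netRate M lam d ⁻¹' Ici (netRate M lam d s₀) := by
    ext s
    refine ⟨fun h => ⟨h.1, h.2 s₀ hs₀⟩, fun h => ⟨h.1, fun s' hs' => (hmax hs').trans h.2⟩⟩
  rw [heq]
  exact isCompact_Icc.of_isClosed_subset (hcont.preimage_isClosed_of_isClosed isClosed_Icc
    isClosed_Ici) inter_subset_left

lemma optRate_mem (lam d : ℝ) : optRate M lam d ∈ Icc 0 M.sbar :=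
  (optRate_mem_optimalRates hM lam d).1

lemma netRate_le_hamiltonian (lam d : ℝ) {s : ℝ} (hs : s ∈ Icc 0 M.sbar) :
    netRate M lam d s ≤ hamiltonian M lam d :=
  (optRate_mem_optimalRates hM lam d).2 s hs

lemma r_zero_le_hamiltonian (lam d : ℝ) : M.r 0 ≤ hamiltonian M lam d := by
  simpa [netRate, hM.f_zero] using netRate_le_hamiltonian hM lam d hM.zero_mem

include hlam

lemma antitone_optRate : Antitone (optRate M lam) := by
  intro d d' hdd
  have hs := optRate_mem_optimalRates hM lam d
  have hs' := optRate_mem_optimalRates hM lam d'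
  set s := optRate M lam d with hsdef
  set s' := optRate M lam d' with hsdef'
  by_contra! hlt
  have hf : M.f s ≤ M.f s' := hM.f_mono hs.1 hs'.1 hlt.le
  have h1 := hs.2 s' hs'.1
  have h2 := hs'.2 s hs.1
  have h3 : 0 ≤ lam * (M.f s' - M.f s) * (d' - d) :=
    mul_nonneg (mul_nonneg hlam (sub_nonneg.2 hf)) (sub_nonneg.2 hdd)
  have hmem : s ∈ optimalRates M lam d' := by
    refine ⟨hs.1, fun s'' hs'' => (hs'.2 s'' hs'').trans ?_⟩
    simp only [netRate] at *
    nlinarith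
  exact absurd (csInf_le ⟨0, fun _ h => h.1.1⟩ hmem) (not_le.2 hlt)

lemma antitone_hamiltonian : Antitone (hamiltonian M lam) := by
  intro d d' hdd
  have hs' := optRate_mem hM lam d'
  refine le_trans ?_ (netRate_le_hamiltonian hM lam d hs')
  have := mul_le_mul_of_nonneg_left hdd (mul_nonneg hlam (hM.f_nonneg hs'))
  simp only [hamiltonian, netRate]
  linarith

lemma hamiltonian_sub_le {d d' : ℝ} (hdd : d ≤ d') :
    hamiltonian M lam d - hamiltonian M lam d' ≤ lam * M.f M.sbar * (d' - d) := by
  have hs := optRate_mem hM lam d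
  have h1 := netRate_le_hamiltonian hM lam d' hs
  have h2 : lam * M.f (optRate M lam d) * (d' - d) ≤ lam * M.f M.sbar * (d' - d) :=
    mul_le_mul_of_nonneg_right (mul_le_mul_of_nonneg_left (hM.f_le hs) hlam) (sub_nonneg.2 hdd)
  have h3 : hamiltonian M lam d = netRate M lam d (optRate M lam d) := rfl
  simp only [netRate] at h1 h3
  linarith

lemma lipschitzWith_hamiltonian :
    LipschitzWith (Real.toNNReal (lam * M.f M.sbar)) (hamiltonian M lam) := by
  have hK : 0 ≤ lam * M.f M.sbar := mul_nonneg hlam (hM.f_nonneg ⟨hM.sbar_pos.le, le_rfl⟩)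
  refine LipschitzWith.of_dist_le_mul fun d d' => ?_
  rw [Real.coe_toNNReal _ hK, Real.dist_eq, Real.dist_eq]
  rcases le_total d d' with h | h
  · rw [abs_of_nonneg (sub_nonneg.2 (antitone_hamiltonian hM hlam h)), abs_sub_comm d,
      abs_of_nonneg (sub_nonneg.2 h)]
    exact hamiltonian_sub_le hM hlam h
  · rw [abs_sub_comm, abs_of_nonneg (sub_nonneg.2 (antitone_hamiltonian hM hlam h)),
      abs_of_nonneg (sub_nonneg.2 h)]
    exact hamiltonian_sub_le hM hlam h

end Hamiltonian

/-- Global solvability on `[0, T]` of `V' = G (V - W)` for a Lipschitz function `G`. -/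
lemma exists_hasDerivAt_comp_sub {G : ℝ → ℝ} {K : ℝ≥0} (hG : LipschitzWith K G) {W : ℝ → ℝ}
    (hW : Continuous W) {T : ℝ} (hT : 0 ≤ T) (v₀ : ℝ) :
    ∃ V : ℝ → ℝ, Continuous V ∧ V 0 = v₀ ∧ ∀ k ∈ Icc 0 T, HasDerivAt V (G (V k - W k)) k := by
  obtain ⟨m, hm⟩ := isCompact_Icc.exists_bound_of_continuousOn
    (hW.continuousOn (s := Icc 0 T))
  have hm0 : 0 ≤ m := (norm_nonneg _).trans (hm 0 ⟨le_rfl, hT⟩)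
  set c := ‖G 0‖ + K * m with hc
  have hc0 : 0 ≤ c := by positivity
  set R := gronwallBound ‖v₀‖ K c T with hR
  have hR0 : 0 ≤ R := by
    refine (norm_nonneg v₀).trans ?_
    rw [← gronwallBound_x0 ‖v₀‖ K c]
    exact gronwallBound_mono (norm_nonneg _) hc0 K.2 hT
  set B := R + m with hB
  have hB0 : 0 ≤ B := add_nonneg hR0 hm0
  let cl : ℝ → ℝ := fun d => max (-B) (min B d)
  have hcl_lip : LipschitzWith 1 cl := (LipschitzWith.id.const_min B).const_max (-B)
  have hcl_le (d : ℝ) : |cl d| ≤ |d| := by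
    simp only [cl]
    rcases abs_cases d with h | h <;> rw [abs_le] <;> constructor <;>
      rcases max_cases (-B) (min B d) with h' | h' <;> rcases min_cases B d with h'' | h'' <;>
      linarith
  have hcl_B (d : ℝ) : |cl d| ≤ B := by
    simp only [cl]
    rw [abs_le]
    exact ⟨le_max_left _ _, max_le (by linarith) (min_le_left _ _)⟩
  have hcl_eq {d : ℝ} (hd : |d| ≤ B) : cl d = d := by
    rw [abs_le] at hd
    simp only [cl]
    rw [min_eq_right hd.2, max_eq_right hd.1]
  have hGb (d : ℝ) : ‖G d‖ ≤ ‖G 0‖ + K * |d| := by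
    have := hG.dist_le_mul d 0
    rw [dist_eq_norm, dist_eq_norm, sub_zero] at this
    have h2 := norm_sub_norm_le (G d) (G 0)
    rw [Real.norm_eq_abs d] at this
    linarith
  let F : ℝ → ℝ → ℝ := fun k v => G (cl (v - W k))
  set L : ℝ≥0 := ⟨‖G 0‖ + K * B, by positivity⟩ with hL
  have hpl : IsPicardLindelof F (⟨0, ⟨le_rfl, hT⟩⟩ : Icc (0 : ℝ) T) v₀ (L * ⟨T, hT⟩) 0 L K := by
    refine ⟨fun k _ => ?_, fun v _ => ?_, fun k _ v _ => ?_, ?_⟩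
    · refine LipschitzWith.lipschitzOnWith ?_
      have h1 : LipschitzWith 1 fun v : ℝ => v - W k :=
        LipschitzWith.of_dist_le_mul fun x y => by simp
      simpa using! hG.comp (hcl_lip.comp h1)
    · exact (hG.continuous.comp (hcl_lip.continuous.comp
        (continuous_const.sub hW))).continuousOn
    · refine (hGb _).trans ?_
      change _ ≤ ‖G 0‖ + K * B
      have := mul_le_mul_of_nonneg_left (hcl_B (v - W k)) K.2
      linarith!
    · change (L : ℝ) * max (T - 0) (0 - 0) ≤ (L : ℝ) * T - 0
      rw [sub_zero, sub_zero, sub_zero, max_eq_left hT]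
  obtain ⟨α, hα⟩ := ODE.FunSpace.exists_isFixedPt_next hpl (Metric.mem_closedBall_self (by simp))
  have hαc : Continuous α.compProj := α.continuous_compProj
  set V : ℝ → ℝ := fun k => v₀ + ∫ κ in (0 : ℝ)..k, F κ (α.compProj κ) with hV
  have hFc : Continuous fun κ => F κ (α.compProj κ) :=
    hG.continuous.comp (hcl_lip.continuous.comp (hαc.sub hW))
  have hVα (k : ℝ) (hk : k ∈ Icc 0 T) : V k = α.compProj k := by
    have h1 : α.compProj k = α ⟨k, hk⟩ := ODE.FunSpace.compProj_of_mem hk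
    rw [h1]
    conv_rhs => rw [← hα]
    rw [ODE.FunSpace.next_apply]
    rfl
  have hVd (k : ℝ) : HasDerivAt V (F k (α.compProj k)) k :=
    (intervalIntegral.integral_hasDerivAt_right (hFc.intervalIntegrable _ _)
      (hFc.stronglyMeasurableAtFilter _ _) hFc.continuousAt).const_add _
  have hVc : Continuous V := continuous_iff_continuousAt.2 fun k => (hVd k).continuousAt
  have hVd' (k : ℝ) (hk : k ∈ Icc 0 T) : HasDerivAt V (F k (V k)) k := by
    rw [hVα k hk]
    exact hVd k
  have hV0 : V 0 = v₀ := by simp [hV]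
  have hbd : ∀ k ∈ Icc 0 T, ‖V k‖ ≤ gronwallBound ‖v₀‖ K c (k - 0) := by
    refine norm_le_gronwallBound_of_norm_deriv_right_le (f' := fun k => F k (V k))
      hVc.continuousOn
      (fun k hk => (hVd' k (Ico_subset_Icc_self hk)).hasDerivWithinAt) (by rw [hV0])
      fun k hk => ?_
    refine (hGb _).trans ?_
    have h1 := hm k (Ico_subset_Icc_self hk)
    have h2 : |cl (V k - W k)| ≤ ‖V k‖ + m :=
      (hcl_le _).trans ((norm_sub_le (V k) (W k)).trans (by linarith))
    have := mul_le_mul_of_nonneg_left h2 K.2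
    rw [hc]
    nlinarith!
  refine ⟨V, hVc, hV0, fun k hk => ?_⟩
  have h1 : |V k - W k| ≤ B := by
    refine (norm_sub_le (V k) (W k)).trans (add_le_add ((hbd k hk).trans ?_) (hm k hk))
    rw [sub_zero]
    exact gronwallBound_mono (norm_nonneg _) hc0 K.2 hk.2
  have h2 := hVd' k hk
  simp only [F] at h2
  rwa [hcl_eq h1] at h2

/-- A function that starts nonnegative and is nondecreasing while it is negative stays
nonnegative. -/
lemma nonneg_of_deriv_nonneg_of_neg {w w' : ℝ → ℝ} {T : ℝ}
    (hw : ∀ k ∈ Icc 0 T, HasDerivAt w (w' k) k) (h0 : 0 ≤ w 0)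
    (hneg : ∀ k ∈ Icc 0 T, w k < 0 → 0 ≤ w' k) : ∀ k ∈ Icc 0 T, 0 ≤ w k := by
  intro k hk
  have key : ∀ ε : ℝ, 0 < ε → -w k ≤ ε * (1 + k) := by
    intro ε hε
    refine image_le_of_deriv_right_lt_deriv_boundary (f := fun k => -w k) (f' := fun k => -w' k)
      (B := fun k => ε * (1 + k)) (B' := fun _ => ε) (a := 0) (b := T)
      (fun k hk => (hw k hk).neg.continuousAt.continuousWithinAt)
      (fun k hk => (hw k (Ico_subset_Icc_self hk)).neg.hasDerivWithinAt) (by simp; linarith)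
      (fun k => by simpa using ((hasDerivAt_id k).const_add 1).const_mul ε)
      (fun k hk heq => ?_) hk
    have h1 : 0 < ε * (1 + k) := mul_pos hε (by linarith [hk.1])
    have := hneg k (Ico_subset_Icc_self hk) (by linarith)
    linarith
  by_contra! hlt
  have h1 : 0 < 1 + k := by linarith [hk.1]
  have := key (-w k / 2 / (1 + k)) (by apply div_pos _ h1; linarith)
  rw [div_mul_cancel₀ _ h1.ne'] at this
  linarith

/-- `V x k` solves the optimality equations on the levels `0, …, ξ` and the time interval
`[0, T]`. -/
structure IsValueFunction (M : Model) (lam T : ℝ) (V : ℕ → ℝ → ℝ) : Prop where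
  continuous : ∀ x, Continuous (V x)
  zero : ∀ x ≤ M.ξ, V x 0 = -M.c x
  hasDerivAt_top : ∀ k ∈ Icc 0 T, HasDerivAt (V M.ξ) (M.r 0) k
  hasDerivAt : ∀ x < M.ξ, ∀ k ∈ Icc 0 T,
    HasDerivAt (V x) (hamiltonian M lam (V x k - V (x + 1) k)) k

section ValueFunction

variable {M : Model} (hM : M.Assumptions) {lam : ℝ} (hlam : 0 ≤ lam) {T : ℝ}
include hM hlam

lemma exists_isValueFunction (hT : 0 ≤ T) : ∃ V, IsValueFunction M lam T V := by
  choose! Φ hΦc hΦ0 hΦd using fun (W : ℝ → ℝ) (hW : Continuous W) (v₀ : ℝ) =>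
    exists_hasDerivAt_comp_sub (lipschitzWith_hamiltonian hM hlam) hW hT v₀
  let U : ℕ → ℝ → ℝ := fun j => Nat.rec (fun k => -M.c M.ξ + M.r 0 * k)
    (fun j W => Φ W (-M.c (M.ξ - (j + 1)))) j
  have hU0 : U 0 = fun k => -M.c M.ξ + M.r 0 * k := rfl
  have hUs (j : ℕ) : U (j + 1) = Φ (U j) (-M.c (M.ξ - (j + 1))) := rfl
  have hUc (j : ℕ) : Continuous (U j) := by
    induction j with
    | zero => rw [hU0]; fun_prop
    | succ j ih => rw [hUs]; exact hΦc _ ih _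
  refine ⟨fun x => U (M.ξ - x), fun x => hUc _, fun x hx => ?_, fun k _ => ?_,
    fun x hx k hk => ?_⟩
  · obtain ⟨j, hj⟩ : ∃ j, M.ξ - x = j := ⟨_, rfl⟩
    simp only [hj]
    cases j with
    | zero =>
      have : M.ξ = x := by omega
      simp [hU0, this]
    | succ j =>
      rw [hUs, hΦ0 _ (hUc j), ← hj]
      congr 2
      omega
  · simp only [Nat.sub_self, hU0]
    simpa using ((hasDerivAt_id k).const_mul (M.r 0)).const_add (-M.c M.ξ)
  · have h1 : M.ξ - x = M.ξ - (x + 1) + 1 := by omega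
    simp only [h1]
    rw [hUs]
    exact hΦd _ (hUc _) _ k hk

lemma IsValueFunction.concave {V : ℕ → ℝ → ℝ} (hV : IsValueFunction M lam T V) {k : ℝ}
    (hk : k ∈ Icc 0 T) : ConcaveOnLevels M.ξ fun x => V x k := by
  suffices H : ∀ n x, x + 2 + n = M.ξ → ∀ k ∈ Icc 0 T,
      0 ≤ (V (x + 1) k - V x k) - (V (x + 2) k - V (x + 1) k) by
    intro x hx
    have := H (M.ξ - (x + 2)) x (by omega) k hk
    simp only
    linarith
  intro n
  induction n with
  | zero =>
    intro x hx
    refine nonneg_of_deriv_nonneg_of_neg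
      (fun k hk => ((hV.hasDerivAt (x + 1) (by omega) k hk).sub
        (hV.hasDerivAt x (by omega) k hk)).sub (((show x + 2 = M.ξ by omega) ▸
          hV.hasDerivAt_top k hk).sub (hV.hasDerivAt (x + 1) (by omega) k hk))) ?_ ?_
    · have := hM.c_convex x (by omega)
      rw [hV.zero x (by omega), hV.zero (x + 1) (by omega), hV.zero (x + 2) (by omega)]
      linarith
    · intro k hk hlt
      have h1 : hamiltonian M lam (V x k - V (x + 1) k)
          ≤ hamiltonian M lam (V (x + 1) k - V (x + 1 + 1) k) :=
        antitone_hamiltonian hM hlam (by linarith)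
      have h2 := r_zero_le_hamiltonian hM lam (V (x + 1) k - V (x + 1 + 1) k)
      linarith
  | succ n ih =>
    intro x hx
    refine nonneg_of_deriv_nonneg_of_neg
      (fun k hk => ((hV.hasDerivAt (x + 1) (by omega) k hk).sub
        (hV.hasDerivAt x (by omega) k hk)).sub ((hV.hasDerivAt (x + 2) (by omega) k hk).sub
          (hV.hasDerivAt (x + 1) (by omega) k hk))) ?_ ?_
    · have := hM.c_convex x (by omega)
      rw [hV.zero x (by omega), hV.zero (x + 1) (by omega), hV.zero (x + 2) (by omega)]
      linarith
    · intro k hk hlt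
      have h0 := ih (x + 1) (by omega) k hk
      have h1 : hamiltonian M lam (V x k - V (x + 1) k)
          ≤ hamiltonian M lam (V (x + 1) k - V (x + 1 + 1) k) :=
        antitone_hamiltonian hM hlam (by linarith)
      have h2 : hamiltonian M lam (V (x + 2) k - V (x + 2 + 1) k)
          ≤ hamiltonian M lam (V (x + 1) k - V (x + 1 + 1) k) :=
        antitone_hamiltonian hM hlam (by
          have : x + 1 + 2 = x + 2 + 1 := by omega
          have : x + 1 + 1 = x + 2 := by omega
          simp_all only
          linarith)
      linarith

end ValueFunction

lemma intervalIntegrable_of_abs_le {a : ℝ → ℝ} (ha : Measurable a) {C : ℝ} (hC : ∀ k, |a k| ≤ C)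
    (p q : ℝ) : IntervalIntegrable a volume p q :=
  (intervalIntegrable_const (c := C)).mono_fun' ha.aestronglyMeasurable (.of_forall hC)

lemma nextEpoch_eq_neg_one_or_mem_Icc (a : ℝ → ℝ) (e k₀ : ℝ) :
    nextEpoch a e k₀ = -1 ∨ nextEpoch a e k₀ ∈ Icc 0 k₀ := by
  unfold nextEpoch
  split_ifs with h
  · right
    obtain ⟨k, hk, hke⟩ := h
    exact ⟨hk.1.trans (le_csSup ⟨k₀, fun _ h => h.1.2⟩ ⟨hk, hke⟩),
      csSup_le ⟨k, hk, hke⟩ fun _ h => h.1.2⟩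
  · exact Or.inl rfl

lemma neg_one_le_nextEpoch (a : ℝ → ℝ) (e k₀ : ℝ) : -1 ≤ nextEpoch a e k₀ := by
  rcases nextEpoch_eq_neg_one_or_mem_Icc a e k₀ with h | h
  · exact h.ge
  · linarith [h.1]

lemma le_nextEpoch_iff {a : ℝ → ℝ} (ha0 : ∀ k, 0 ≤ a k)
    (hai : ∀ p q, IntervalIntegrable a volume p q) {q : ℝ} (hq : 0 ≤ q) (e k₀ : ℝ) :
    q ≤ nextEpoch a e k₀ ↔ q ≤ k₀ ∧ e ≤ ∫ κ in q..k₀, a κ := by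
  set S : Set ℝ := {k | k ∈ Icc 0 k₀ ∧ e ≤ ∫ κ in k..k₀, a κ} with hS
  have hcont : Continuous fun k => ∫ κ in k..k₀, a κ := by
    have h1 : (fun k => ∫ κ in k..k₀, a κ) = fun k => -∫ κ in k₀..k, a κ := by
      ext k
      rw [intervalIntegral.integral_symm]
    rw [h1]
    exact (intervalIntegral.continuous_primitive hai k₀).neg
  by_cases h : ∃ k ∈ Icc 0 k₀, e ≤ ∫ κ in k..k₀, a κ
  · have hτ : nextEpoch a e k₀ = sSup S := by
      unfold nextEpoch
      rw [if_pos h]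
    have hSne : S.Nonempty := h
    have hSbd : BddAbove S := ⟨k₀, fun _ h => h.1.2⟩
    have hScl : IsClosed S := by
      have : S = Icc 0 k₀ ∩ (fun k => ∫ κ in k..k₀, a κ) ⁻¹' Ici e := rfl
      rw [this]
      exact isClosed_Icc.inter (isClosed_Ici.preimage hcont)
    have hmem : sSup S ∈ S := hScl.csSup_mem hSne hSbd
    rw [hτ]
    constructor
    · intro hqs
      refine ⟨hqs.trans hmem.1.2, hmem.2.trans ?_⟩
      rw [← intervalIntegral.integral_add_adjacent_intervals (hai q (sSup S)) (hai _ k₀)]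
      linarith [intervalIntegral.integral_nonneg (f := a) (μ := volume) hqs fun k _ => ha0 k]
    · rintro ⟨h1, h2⟩
      exact le_csSup hSbd ⟨⟨hq, h1⟩, h2⟩
  · have hτ : nextEpoch a e k₀ = -1 := by
      unfold nextEpoch
      rw [if_neg h]
    rw [hτ]
    constructor
    · intro h'
      linarith
    · rintro ⟨h1, h2⟩
      exact absurd ⟨q, ⟨hq, h1⟩, h2⟩ h

lemma measurable_nextEpoch {Ω : Type*} [MeasurableSpace Ω] {a : Ω → ℝ → ℝ}
    (ham : Measurable (Function.uncurry a)) (ha0 : ∀ ω k, 0 ≤ a ω k) {C : ℝ}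
    (haC : ∀ ω k, a ω k ≤ C) {e k₀ : Ω → ℝ} (he : Measurable e) (hk₀ : Measurable k₀) :
    Measurable fun ω => nextEpoch (a ω) (e ω) (k₀ ω) := by
  have hai (ω : Ω) (p q : ℝ) : IntervalIntegrable (a ω) volume p q :=
    intervalIntegrable_of_abs_le (a := a ω) (ham.comp measurable_prodMk_left)
      (fun k => (abs_of_nonneg (ha0 ω k)).trans_le (haC ω k)) p q
  have key (q : ℝ) (hq : 0 ≤ q) :
      MeasurableSet {ω | q ≤ nextEpoch (a ω) (e ω) (k₀ ω)} := by
    set I : Ω × ℝ → ℝ := indicator {p | q < p.2 ∧ p.2 ≤ k₀ p.1} (Function.uncurry a) with hI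
    have hIm : Measurable I := ham.indicator
      ((measurableSet_lt measurable_const measurable_snd).inter
        (measurableSet_le measurable_snd (hk₀.comp measurable_fst)))
    have hJm : Measurable fun ω => ∫ κ, I (ω, κ) :=
      (hIm.stronglyMeasurable.integral_prod_right' (ν := volume)).measurable
    have heq : {ω | q ≤ nextEpoch (a ω) (e ω) (k₀ ω)}
        = {ω | q ≤ k₀ ω} ∩ {ω | e ω ≤ ∫ κ, I (ω, κ)} := by
      ext ω
      simp only [mem_ofPred_eq, mem_inter_iff, le_nextEpoch_iff (ha0 ω) (hai ω) hq]
      refine and_congr_right fun h => ?_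
      rw [intervalIntegral.integral_of_le h, ← integral_indicator measurableSet_Ioc]
      rfl
    rw [heq]
    exact (measurableSet_le measurable_const hk₀).inter (measurableSet_le he hJm)
  refine measurable_of_Ici fun q => ?_
  rcases le_or_gt q (-1) with h1 | h1
  · convert MeasurableSet.univ
    refine eq_univ_of_forall fun ω => ?_
    exact h1.trans (neg_one_le_nextEpoch _ _ _)
  rcases le_or_gt q 0 with h0 | h0
  · convert key 0 le_rfl using 1
    ext ω
    simp only [mem_preimage, mem_Ici, mem_ofPred_eq]
    refine ⟨fun h => ?_, fun h => h0.trans h⟩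
    rcases nextEpoch_eq_neg_one_or_mem_Icc (a ω) (e ω) (k₀ ω) with h' | h'
    · linarith
    · exact h'.1
  · exact key q h0.le

lemma expMeasure_real_Iic {b : ℝ} (hb : 0 ≤ b) :
    (expMeasure 1).real (Iic b) = 1 - Real.exp (-b) := by
  have := isProbabilityMeasure_expMeasure one_pos
  rw [← cdf_eq_real, cdf_expMeasure_eq one_pos, if_pos hb, one_mul]

section FirstEpoch

variable {a : ℝ → ℝ} (ham : Measurable a) (ha0 : ∀ k, 0 ≤ a k) {C : ℝ} (haC : ∀ k, a k ≤ C)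
include ham ha0 haC

lemma intervalIntegrable_intensity (p q : ℝ) : IntervalIntegrable a volume p q :=
  intervalIntegrable_of_abs_le ham (fun k => by rw [abs_of_nonneg (ha0 k)]; exact haC k) p q

lemma continuous_integral_intensity (t : ℝ) : Continuous fun k => ∫ κ in k..t, a κ := by
  have h1 : (fun k => ∫ κ in k..t, a κ) = fun k => -∫ κ in t..k, a κ := by
    ext k
    rw [intervalIntegral.integral_symm]
  rw [h1]
  exact (intervalIntegral.continuous_primitive (intervalIntegrable_intensity ham ha0 haC) t).neg

lemma integral_intensity_mul_exp {q t : ℝ} (hqt : q ≤ t) :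
    ∫ k in q..t, a k * Real.exp (-∫ κ in k..t, a κ) = 1 - Real.exp (-∫ κ in q..t, a κ) := by
  have hai := intervalIntegrable_intensity ham ha0 haC
  set g : ℝ → ℝ := fun k => Real.exp (-∫ κ in k..t, a κ) with hg
  have hgeq : g = fun k => Real.exp (∫ κ in t..k, a κ) := by
    ext k
    simp only [hg]
    rw [intervalIntegral.integral_symm k t]
  have hac : AbsolutelyContinuousOnInterval g q t := by
    have hC0 : 0 ≤ C := (ha0 0).trans (haC 0)
    refine LipschitzOnWith.absolutelyContinuousOnInterval (K := Real.toNNReal C) ?_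
    rw [uIcc_of_le hqt]
    have hmono (k k' : ℝ) (hk : k' ≤ t) (hkk : k ≤ k') :
        |g k' - g k| ≤ C * (k' - k) := by
      have h1 : 0 ≤ ∫ κ in k..k', a κ := intervalIntegral.integral_nonneg hkk fun k _ => ha0 k
      have h2 : ∫ κ in k..k', a κ ≤ C * (k' - k) := by
        refine (intervalIntegral.integral_mono hkk (hai k k') intervalIntegrable_const
          fun κ => haC κ).trans ?_
        simp [mul_comm]
      have h3 : ∫ κ in t..k, a κ = (∫ κ in t..k', a κ) - ∫ κ in k..k', a κ := by
        rw [← intervalIntegral.integral_add_adjacent_intervals (hai t k) (hai k k')]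
        ring
      have h4 : g k' ≤ 1 := by
        rw [hg]
        refine Real.exp_le_one_iff.2 ?_
        linarith [intervalIntegral.integral_nonneg (f := a) (μ := volume) hk fun k _ => ha0 k]
      have h5 : g k = g k' * Real.exp (-∫ κ in k..k', a κ) := by
        rw [hgeq]
        simp only
        rw [h3, ← Real.exp_add]
        congr 1
      have h6 := Real.add_one_le_exp (-∫ κ in k..k', a κ)
      have h7 : Real.exp (-∫ κ in k..k', a κ) ≤ 1 := Real.exp_le_one_iff.2 (by linarith)
      have h8 : 0 ≤ g k' := (Real.exp_pos _).le
      rw [h5, abs_of_nonneg (by nlinarith)]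
      nlinarith
    refine LipschitzOnWith.of_dist_le_mul fun k hk k' hk' => ?_
    rw [Real.coe_toNNReal _ hC0, Real.dist_eq, Real.dist_eq]
    rcases le_total k k' with h | h
    · rw [abs_sub_comm, abs_sub_comm k, abs_of_nonneg (sub_nonneg.2 h)]
      exact hmono k k' hk'.2 h
    · rw [abs_of_nonneg (sub_nonneg.2 h)]
      exact hmono k' k hk.2 h
  have hftc := hac.integral_deriv_eq_sub
  have hgt : g t = 1 := by simp [hg]
  rw [hgt] at hftc
  rw [← hftc]
  refine intervalIntegral.integral_congr_ae ?_
  filter_upwards [(hai q t).ae_hasDerivAt_integral] with k hk hkm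
  have h1 := hk (uIoc_subset_uIcc hkm) t right_mem_uIcc
  have h2 : HasDerivAt g (Real.exp (∫ κ in t..k, a κ) * a k) k := by
    rw [hgeq]
    exact h1.exp
  rw [h2.deriv, mul_comm, intervalIntegral.integral_symm k t]

lemma expMeasure_real_le_nextEpoch {q t : ℝ} (hq : q ∈ Icc 0 t) :
    (expMeasure 1).real {y | q ≤ nextEpoch a y t} = 1 - Real.exp (-∫ κ in q..t, a κ) := by
  rw [← expMeasure_real_Iic (intervalIntegral.integral_nonneg hq.2 fun k _ => ha0 k)]
  congr 1
  ext y
  simp [le_nextEpoch_iff ha0 (intervalIntegrable_intensity ham ha0 haC) hq.1, hq.2]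

lemma measurable_nextEpoch_threshold (t : ℝ) : Measurable fun y => nextEpoch a y t :=
  measurable_nextEpoch (a := fun _ : ℝ => a) (ham.comp measurable_snd) (fun _ => ha0)
    (fun _ => haC) measurable_id measurable_const

lemma map_nextEpoch_restrict (t : ℝ) :
    ((expMeasure 1).map fun y => nextEpoch a y t).restrict (Ici 0)
      = (volume.restrict (Icc 0 t)).withDensity
          fun k => ENNReal.ofReal (a k * Real.exp (-∫ κ in k..t, a κ)) := by
  have := isProbabilityMeasure_expMeasure one_pos
  have hτ := measurable_nextEpoch_threshold ham ha0 haC t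
  have hdm : Measurable fun k => a k * Real.exp (-∫ κ in k..t, a κ) :=
    ham.mul (continuous_integral_intensity ham ha0 haC t).measurable.neg.exp
  refine Measure.ext_of_Ici _ _ fun q => ?_
  have hIci : Ici q ∩ Ici (0 : ℝ) = Ici (max q 0) := by ext; simp
  have hIcc : Ici q ∩ Icc (0 : ℝ) t = Icc (max q 0) t := by ext; simp [and_assoc]
  rw [Measure.restrict_apply measurableSet_Ici, hIci, Measure.map_apply hτ measurableSet_Ici,
    withDensity_apply _ measurableSet_Ici, Measure.restrict_restrict measurableSet_Ici, hIcc]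
  set p := max q 0 with hp
  have hp0 : 0 ≤ p := le_max_right _ _
  rcases le_or_gt p t with hpt | hpt
  · have h1 := expMeasure_real_le_nextEpoch ham ha0 haC ⟨hp0, hpt⟩
    have h2 := integral_intensity_mul_exp ham ha0 haC hpt
    rw [← h2, intervalIntegral.integral_of_le hpt, ← integral_Icc_eq_integral_Ioc] at h1
    have h3 : IntegrableOn (fun k => a k * Real.exp (-∫ κ in k..t, a κ)) (Icc p t) :=
      Measure.integrableOn_of_bounded (M := C) (by simp) hdm.aestronglyMeasurable (by
        refine (ae_restrict_iff' measurableSet_Icc).2 (.of_forall fun k hk => ?_)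
        have h4 : Real.exp (-∫ κ in k..t, a κ) ≤ 1 := Real.exp_le_one_iff.2 (by
          linarith [intervalIntegral.integral_nonneg (f := a) (μ := volume) hk.2
            fun k _ => ha0 k])
        rw [Real.norm_eq_abs, abs_of_nonneg (mul_nonneg (ha0 k) (Real.exp_pos _).le)]
        exact (mul_le_of_le_one_right (ha0 k) h4).trans (haC k))
    rw [← ofReal_integral_eq_lintegral_ofReal h3
      (.of_forall fun k => mul_nonneg (ha0 k) (Real.exp_pos _).le), ← h1, ofReal_measureReal]
    rfl
  · have h1 : (fun y => nextEpoch a y t) ⁻¹' Ici p = ∅ := by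
      ext y
      simp [le_nextEpoch_iff ha0 (intervalIntegrable_intensity ham ha0 haC) hp0, hpt]
    simp [h1, Icc_eq_empty (not_le.2 hpt)]

/-- The compensator identity for the first epoch: the expected cost `d` paid at the first epoch is
the expected integral of `d` against the intensity up to that epoch. -/
lemma integral_nextEpoch {t : ℝ} (ht : 0 ≤ t) {d : ℝ → ℝ} (hd : Continuous d) :
    ∫ y, (if 0 ≤ nextEpoch a y t then d (nextEpoch a y t) else 0) ∂expMeasure 1
      = ∫ y, (∫ k in max (nextEpoch a y t) 0..t, a k * d k) ∂expMeasure 1 := by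
  have := isProbabilityMeasure_expMeasure one_pos
  have hτ := measurable_nextEpoch_threshold ham ha0 haC t
  have hdm : Measurable fun k => a k * Real.exp (-∫ κ in k..t, a κ) :=
    ham.mul (continuous_integral_intensity ham ha0 haC t).measurable.neg.exp
  have hL : ∫ y, (if 0 ≤ nextEpoch a y t then d (nextEpoch a y t) else 0) ∂expMeasure 1
      = ∫ k in Icc 0 t, a k * Real.exp (-∫ κ in k..t, a κ) * d k := by
    have h1 : ∫ y, (if 0 ≤ nextEpoch a y t then d (nextEpoch a y t) else 0) ∂expMeasure 1
        = ∫ k, d k ∂((expMeasure 1).map fun y => nextEpoch a y t).restrict (Ici 0) := by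
      rw [← integral_indicator measurableSet_Ici, integral_map hτ.aemeasurable
        (hd.measurable.indicator measurableSet_Ici).aestronglyMeasurable]
      rfl
    rw [h1, map_nextEpoch_restrict ham ha0 haC, integral_withDensity_eq_integral_toReal_smul
      hdm.ennreal_ofReal (.of_forall fun _ => ENNReal.ofReal_lt_top)]
    refine integral_congr_ae (.of_forall fun k => ?_)
    simp only [smul_eq_mul]
    rw [ENNReal.toReal_ofReal (mul_nonneg (ha0 k) (Real.exp_pos _).le)]
  obtain ⟨m, hm⟩ := isCompact_Icc.exists_bound_of_continuousOn (hd.continuousOn (s := Icc 0 t))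
  set F : ℝ → ℝ → ℝ := fun y k => if nextEpoch a y t < k then a k * d k else 0 with hF
  have hFm : Measurable (Function.uncurry F) :=
    Measurable.ite (measurableSet_lt (hτ.comp measurable_fst) measurable_snd)
      ((ham.mul hd.measurable).comp measurable_snd) measurable_const
  have hR (y : ℝ) : ∫ k in max (nextEpoch a y t) 0..t, a k * d k = ∫ k in Icc 0 t, F y k := by
    have hle : max (nextEpoch a y t) 0 ≤ t := by
      rcases nextEpoch_eq_neg_one_or_mem_Icc a y t with h | h
      · rw [h]; simp [ht]
      · exact max_le h.2 ht
    rw [intervalIntegral.integral_of_le hle, integral_Icc_eq_integral_Ioc,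
      ← integral_indicator measurableSet_Ioc, ← integral_indicator measurableSet_Ioc]
    refine integral_congr_ae (.of_forall fun k => ?_)
    simp only [indicator, mem_Ioc, hF, max_lt_iff]
    split_ifs <;> first | rfl | (exfalso; tauto)
  rw [hL, integral_congr_ae (.of_forall hR), integral_integral_swap]
  · refine setIntegral_congr_fun measurableSet_Icc fun k hk => ?_
    have h1 : ∀ y, F y k = indicator {y | k ≤ nextEpoch a y t}ᶜ (fun _ => a k * d k) y := by
      intro y
      simp [hF, indicator]
    refine Eq.trans ?_ (integral_congr_ae (.of_forall h1)).symm
    have hms : MeasurableSet {y | k ≤ nextEpoch a y t} := measurableSet_le measurable_const hτ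
    rw [integral_indicator hms.compl, setIntegral_const, probReal_compl_eq_one_sub hms,
      expMeasure_real_le_nextEpoch ham ha0 haC hk, smul_eq_mul]
    ring
  · refine Integrable.of_bound (C := C * m) hFm.aestronglyMeasurable ?_
    have hC0 : 0 ≤ C := (ha0 0).trans (haC 0)
    have hm0 : 0 ≤ m := (norm_nonneg _).trans (hm 0 ⟨le_rfl, ht⟩)
    have h1 : ∀ᵐ k ∂volume.restrict (Icc 0 t), k ∈ Icc 0 t := ae_restrict_mem measurableSet_Icc
    have h2 : ∀ᵐ p ∂(expMeasure 1).prod (volume.restrict (Icc 0 t)), p.2 ∈ Icc 0 t :=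
      Measure.quasiMeasurePreserving_snd.ae h1
    filter_upwards [h2] with p hp
    simp only [Function.uncurry, hF]
    split_ifs
    · rw [norm_mul, Real.norm_eq_abs, abs_of_nonneg (ha0 _)]
      exact mul_le_mul (haC _) (hm _ hp) (norm_nonneg _) hC0
    · simpa using mul_nonneg hC0 hm0

end FirstEpoch

instance : IsProbabilityMeasure (expMeasure 1) := isProbabilityMeasure_expMeasure one_pos

instance : IsProbabilityMeasure clockLaw := by
  unfold clockLaw
  infer_instance

lemma measurable_update_pair (x : ℕ) :
    Measurable fun p : ℝ × Clocks => Function.update p.2 x p.1 := by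
  refine measurable_pi_lambda _ fun i => ?_
  by_cases h : i = x
  · subst h
    simpa using measurable_fst
  · simp only [Function.update_of_ne h]
    exact (measurable_pi_apply i).comp measurable_snd

/-- Resampling one threshold does not change the law of the thresholds. -/
lemma map_update_clockLaw (x : ℕ) :
    ((expMeasure 1).prod clockLaw).map (fun p => Function.update p.2 x p.1) = clockLaw := by
  refine Measure.eq_infinitePi _ fun s A hA => ?_
  rw [Measure.map_apply (measurable_update_pair x)
    (MeasurableSet.pi s.countable_toSet fun i _ => hA i)]
  by_cases hx : x ∈ s
  · have h1 : (fun p : ℝ × Clocks => Function.update p.2 x p.1) ⁻¹' Set.pi s A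
        = A x ×ˢ Set.pi (s.erase x : Finset ℕ) A := by
      ext p
      simp only [mem_preimage, Set.mem_pi, mem_prod, Finset.mem_coe, Finset.mem_erase]
      constructor
      · intro h
        refine ⟨by simpa using h x hx, fun i hi => ?_⟩
        simpa [Function.update_of_ne hi.1] using h i hi.2
      · rintro ⟨h, h'⟩ i hi
        by_cases hix : i = x
        · subst hix
          simpa using h
        · simpa [Function.update_of_ne hix] using h' i ⟨hix, hi⟩
    rw [h1, Measure.prod_prod, clockLaw, Measure.infinitePi_pi _ fun i _ => hA i,
      Finset.mul_prod_erase s (fun i => expMeasure 1 (A i)) hx]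
  · have h1 : (fun p : ℝ × Clocks => Function.update p.2 x p.1) ⁻¹' Set.pi s A
        = univ ×ˢ Set.pi s A := by
      ext p
      simp only [mem_preimage, Set.mem_pi, mem_prod, Finset.mem_coe, mem_univ, true_and]
      refine forall₂_congr fun i hi => ?_
      rw [Function.update_of_ne (by rintro rfl; exact hx hi)]
    rw [h1, Measure.prod_prod, clockLaw, Measure.infinitePi_pi _ fun i _ => hA i, measure_univ,
      one_mul]

lemma measurable_comp_of_continuousOn {α : Type*} [MeasurableSpace α] {g : ℝ → ℝ} {b c : ℝ}
    (hbc : b ≤ c) (hg : ContinuousOn g (Icc b c)) {φ : α → ℝ} (hφ : Measurable φ)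
    (hmem : ∀ ω, φ ω ∈ Icc b c) : Measurable fun ω => g (φ ω) := by
  have h1 : (fun ω => g (φ ω)) = fun ω => IccExtend hbc ((Icc b c).domRestrict g) (φ ω) := by
    ext ω
    rw [IccExtend_of_mem _ _ (hmem ω)]
    rfl
  rw [h1]
  exact ((continuousOn_iff_continuous_domRestrict.1 hg).Icc_extend').measurable.comp hφ

/-- The policy that remains in force after a first increment at the remaining time `τ`. -/
def Policy.shift {M : Model} (u : Policy M) (τ : ℝ) : Policy M where
  rate y n h k := u.rate y (n + 1) (Fin.cons τ h) k
  measurable_rate y n := by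
    have h1 : Measurable fun p : (Fin n → ℝ) × ℝ =>
        ((Fin.cons τ p.1 : Fin (n + 1) → ℝ), p.2) := by
      refine Measurable.prodMk (measurable_pi_lambda _ fun i => ?_) measurable_snd
      refine Fin.cases ?_ (fun j => ?_) i
      · simp
      · simp only [Fin.cons_succ]
        exact (measurable_pi_apply j).comp measurable_fst
    exact (u.measurable_rate y (n + 1)).comp h1
  rate_mem y n h k := u.rate_mem y (n + 1) _ k
  off n h k := u.off (n + 1) _ k

/-- The revenue minus the maintenance cost on a sample path. -/
def pathProfit (M : Model) (lam : ℝ) (u : Policy M) (x : ℕ) (t : ℝ) (e : Clocks) : ℝ :=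
  (∫ k in (0 : ℝ)..t, M.r (productionRate M lam u x t e k)) - M.c (level M lam u x t e 0)

/-- The intensity of increments, as long as none has occurred. -/
def firstIntensity (M : Model) (lam : ℝ) (u : Policy M) (x : ℕ) (k : ℝ) : ℝ :=
  lam * M.f (u.rate x 0 Fin.elim0 k)

section Dynamics

variable {M : Model} {lam : ℝ} {u : Policy M} {x : ℕ} {t : ℝ} {e : Clocks}

lemma epochs_last (n : ℕ) :
    epochs M lam u x t e (n + 1) (Fin.last n)
      = nextEpoch (fun κ => lam * M.f (u.rate (x + n) n (epochs M lam u x t e n) κ)) (e (x + n))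
          (lastEpoch t (epochs M lam u x t e n)) := by
  rw [epochs, Fin.snoc_last]

lemma epochs_last_zero :
    epochs M lam u x t e 1 (Fin.last 0) = nextEpoch (firstIntensity M lam u x) (e x) t :=
  epochs_last 0

lemma neg_one_le_epochs_last (n : ℕ) : -1 ≤ epochs M lam u x t e (n + 1) (Fin.last n) := by
  rw [epochs_last]
  exact neg_one_le_nextEpoch _ _ _

lemma antitone_epochs_last : Antitone fun n => epochs M lam u x t e (n + 1) (Fin.last n) := by
  refine antitone_nat_of_succ_le fun n => ?_
  have h0 := neg_one_le_epochs_last (M := M) (lam := lam) (u := u) (x := x) (t := t) (e := e) n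
  rw [epochs_last (n + 1)]
  rcases nextEpoch_eq_neg_one_or_mem_Icc
    (fun κ => lam * M.f (u.rate (x + (n + 1)) (n + 1) (epochs M lam u x t e (n + 1)) κ))
    (e (x + (n + 1))) (lastEpoch t (epochs M lam u x t e (n + 1))) with h | h
  · rw [h]
    exact h0
  · exact h.2

lemma epochs_congr {e' : Clocks} (h : ∀ i, x ≤ i → e i = e' i) (n : ℕ) :
    epochs M lam u x t e n = epochs M lam u x t e' n := by
  induction n with
  | zero => rfl
  | succ n ih => rw [epochs, epochs, ih, h (x + n) (by omega)]

lemma numIncrements_congr {e' : Clocks} (h : ∀ i, x ≤ i → e i = e' i) (k : ℝ) :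
    numIncrements M lam u x t e k = numIncrements M lam u x t e' k := by
  simp only [numIncrements, epochs_congr h]

lemma productionRate_congr {e' : Clocks} (h : ∀ i, x ≤ i → e i = e' i) (k : ℝ) :
    productionRate M lam u x t e k = productionRate M lam u x t e' k := by
  change (fun N => u.rate (x + N) N (epochs M lam u x t e N) k) (numIncrements M lam u x t e k) = _
  rw [numIncrements_congr h]
  simp only [epochs_congr h]
  rfl

lemma pathProfit_congr {e' : Clocks} (h : ∀ i, x ≤ i → e i = e' i) :
    pathProfit M lam u x t e = pathProfit M lam u x t e' := by
  simp only [pathProfit, productionRate_congr h, level, numIncrements_congr h]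

lemma lastEpoch_cons (t τ : ℝ) {n : ℕ} (h : Fin n → ℝ) :
    lastEpoch t (Fin.cons τ h : Fin (n + 1) → ℝ) = lastEpoch τ h := by
  cases n with
  | zero => rfl
  | succ n => rfl

lemma epochs_succ {τ : ℝ} (hτ : nextEpoch (firstIntensity M lam u x) (e x) t = τ) (n : ℕ) :
    epochs M lam u x t e (n + 1)
      = Fin.cons τ (epochs M lam (u.shift τ) (x + 1) τ e n) := by
  induction n with
  | zero =>
    ext i
    rw [show i = Fin.last 0 from Fin.fin_one_eq_zero i, epochs_last_zero, hτ]
    rfl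
  | succ n ih =>
    have hx : x + (n + 1) = x + 1 + n := by omega
    rw [epochs, ih, epochs, Fin.cons_snoc_eq_snoc_cons, lastEpoch_cons, hx]
    rfl

lemma epochs_last_succ {τ : ℝ} (hτ : nextEpoch (firstIntensity M lam u x) (e x) t = τ) (n : ℕ) :
    epochs M lam u x t e (n + 1 + 1) (Fin.last (n + 1))
      = epochs M lam (u.shift τ) (x + 1) τ e (n + 1) (Fin.last n) := by
  rw [epochs_succ hτ, ← Fin.succ_last, Fin.cons_succ]

lemma numIncrements_eq_zero {k : ℝ} (hk : nextEpoch (firstIntensity M lam u x) (e x) t < k) :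
    numIncrements M lam u x t e k = 0 := by
  rw [numIncrements, Finset.card_eq_zero, Finset.filter_eq_empty_iff]
  intro n _
  rw [not_le]
  refine lt_of_le_of_lt (antitone_epochs_last (Nat.zero_le n)) ?_
  simpa only [epochs_last_zero] using! hk

lemma numIncrements_succ {τ : ℝ} (hτ : nextEpoch (firstIntensity M lam u x) (e x) t = τ)
    (hx : x < M.ξ) {k : ℝ} (hk : k ≤ τ) :
    numIncrements M lam u x t e k = numIncrements M lam (u.shift τ) (x + 1) τ e k + 1 := by
  obtain ⟨m, hm⟩ : ∃ m, M.ξ - x = m + 1 := ⟨M.ξ - x - 1, by omega⟩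
  have hm' : M.ξ - (x + 1) = m := by omega
  simp only [numIncrements, hm, hm', Finset.card_filter, Finset.sum_range_succ',
    epochs_last_succ hτ]
  congr 1
  rw [if_pos]
  exact hk.trans (hτ ▸ epochs_last_zero.ge)

lemma productionRate_eq_first {k : ℝ} (hk : nextEpoch (firstIntensity M lam u x) (e x) t < k) :
    productionRate M lam u x t e k = u.rate x 0 Fin.elim0 k := by
  change (fun N => u.rate (x + N) N (epochs M lam u x t e N) k) (numIncrements M lam u x t e k) = _
  rw [numIncrements_eq_zero hk]
  rfl

lemma productionRate_eq_shift {τ : ℝ} (hτ : nextEpoch (firstIntensity M lam u x) (e x) t = τ)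
    (hx : x < M.ξ) {k : ℝ} (hk : k ≤ τ) :
    productionRate M lam u x t e k = productionRate M lam (u.shift τ) (x + 1) τ e k := by
  change (fun N => u.rate (x + N) N (epochs M lam u x t e N) k) (numIncrements M lam u x t e k) = _
  rw [numIncrements_succ hτ hx hk]
  simp only [epochs_succ hτ, productionRate, level, Policy.shift]
  congr 1
  omega

lemma level_eq_shift {τ : ℝ} (hτ : nextEpoch (firstIntensity M lam u x) (e x) t = τ)
    (hx : x < M.ξ) {k : ℝ} (hk : k ≤ τ) :
    level M lam u x t e k = level M lam (u.shift τ) (x + 1) τ e k := by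
  rw [level, level, numIncrements_succ hτ hx hk]
  omega

lemma productionRate_mem (k : ℝ) : productionRate M lam u x t e k ∈ Icc 0 M.sbar :=
  u.rate_mem _ _ _ _

lemma level_le (hx : x ≤ M.ξ) (k : ℝ) : level M lam u x t e k ≤ M.ξ := by
  have h1 := Finset.card_filter_le (Finset.range (M.ξ - x))
    fun n => k ≤ epochs M lam u x t e (n + 1) (Fin.last n)
  rw [Finset.card_range] at h1
  rw [level, numIncrements]
  omega

end Dynamics

section Measurability

variable {M : Model} (hM : M.Assumptions) {lam : ℝ} (hlam : 0 ≤ lam) (u : Policy M) (x : ℕ)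
  (t : ℝ)
include hM

lemma abs_r_le {s : ℝ} (hs : s ∈ Icc 0 M.sbar) : |M.r s| ≤ |M.r 0| + |M.r M.sbar| := by
  have h1 := hM.r_mono hM.zero_mem hs hs.1
  have h2 := hM.r_mono hs ⟨hM.sbar_pos.le, le_rfl⟩ hs.2
  rw [abs_le]
  constructor
  · linarith [neg_abs_le (M.r 0), abs_nonneg (M.r M.sbar)]
  · linarith [le_abs_self (M.r M.sbar), abs_nonneg (M.r 0)]

lemma measurable_r_rate : Measurable fun k => M.r (u.rate x 0 Fin.elim0 k) :=
  measurable_comp_of_continuousOn hM.sbar_pos.le hM.r_cont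
    ((u.measurable_rate x 0).comp measurable_prodMk_left) fun _ => u.rate_mem _ _ _ _

lemma measurable_firstIntensity : Measurable (firstIntensity M lam u x) :=
  (measurable_comp_of_continuousOn hM.sbar_pos.le hM.f_cont
    ((u.measurable_rate x 0).comp measurable_prodMk_left) fun _ => u.rate_mem _ _ _ _).const_mul
      lam

include hlam

lemma firstIntensity_nonneg (k : ℝ) : 0 ≤ firstIntensity M lam u x k :=
  mul_nonneg hlam (hM.f_nonneg (u.rate_mem _ _ _ _))

lemma firstIntensity_le (k : ℝ) : firstIntensity M lam u x k ≤ lam * M.f M.sbar :=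
  mul_le_mul_of_nonneg_left (hM.f_le (u.rate_mem _ _ _ _)) hlam

lemma measurable_epochs (n : ℕ) : Measurable fun e => epochs M lam u x t e n := by
  induction n with
  | zero => exact measurable_const
  | succ n ih =>
    have hlast : Measurable fun e => lastEpoch t (epochs M lam u x t e n) := by
      cases n with
      | zero => exact measurable_const
      | succ n => exact (measurable_pi_apply (Fin.last n)).comp ih
    have hrate : Measurable fun p : Clocks × ℝ =>
        u.rate (x + n) n (epochs M lam u x t p.1 n) p.2 :=
      (u.measurable_rate (x + n) n).comp ((ih.comp measurable_fst).prodMk measurable_snd)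
    have hnext : Measurable fun e : Clocks =>
        nextEpoch (fun κ => lam * M.f (u.rate (x + n) n (epochs M lam u x t e n) κ)) (e (x + n))
          (lastEpoch t (epochs M lam u x t e n)) :=
      measurable_nextEpoch
        (a := fun e κ => lam * M.f (u.rate (x + n) n (epochs M lam u x t e n) κ))
        ((measurable_comp_of_continuousOn hM.sbar_pos.le hM.f_cont hrate
          fun _ => u.rate_mem _ _ _ _).const_mul lam)
        (fun _ _ => mul_nonneg hlam (hM.f_nonneg (u.rate_mem _ _ _ _)))
        (fun _ _ => mul_le_mul_of_nonneg_left (hM.f_le (u.rate_mem _ _ _ _)) hlam)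
        (measurable_pi_apply _) hlast
    refine measurable_pi_lambda _ fun i => ?_
    refine Fin.lastCases ?_ (fun j => ?_) i
    · simpa only [epochs, Fin.snoc_last] using hnext
    · simp only [epochs, Fin.snoc_castSucc]
      exact (measurable_pi_apply j).comp ih

lemma measurable_numIncrements :
    Measurable fun p : Clocks × ℝ => numIncrements M lam u x t p.1 p.2 := by
  simp only [numIncrements, Finset.card_filter]
  refine Finset.measurable_sum _ fun n _ => Measurable.ite (measurableSet_le measurable_snd ?_)
    measurable_const measurable_const
  exact (measurable_pi_apply (Fin.last n)).comp
    ((measurable_epochs hM hlam u x t (n + 1)).comp measurable_fst)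

lemma measurable_productionRate :
    Measurable fun p : Clocks × ℝ => productionRate M lam u x t p.1 p.2 := by
  have h1 : Measurable fun q : ℕ × (Clocks × ℝ) =>
      u.rate (x + q.1) q.1 (epochs M lam u x t q.2.1 q.1) q.2.2 :=
    measurable_from_prod_countable_right fun n => (u.measurable_rate (x + n) n).comp
      (((measurable_epochs hM hlam u x t n).comp measurable_fst).prodMk measurable_snd)
  exact h1.comp ((measurable_numIncrements hM hlam u x t).prodMk measurable_id)

lemma measurable_pathProfit (ht : 0 ≤ t) : Measurable (pathProfit M lam u x t) := by
  have hr : Measurable fun p : Clocks × ℝ => M.r (productionRate M lam u x t p.1 p.2) :=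
    measurable_comp_of_continuousOn hM.sbar_pos.le hM.r_cont
      (measurable_productionRate hM hlam u x t) fun _ => productionRate_mem _
  have hint : Measurable fun e => ∫ k in (0 : ℝ)..t, M.r (productionRate M lam u x t e k) := by
    simp only [intervalIntegral.integral_of_le ht]
    exact (hr.stronglyMeasurable.integral_prod_right'
      (ν := volume.restrict (Ioc 0 t))).measurable
  refine hint.sub (measurable_from_nat.comp (measurable_const.add ?_))
  exact (measurable_numIncrements hM hlam u x t).comp measurable_prodMk_right

omit hlam in
lemma abs_pathProfit_le (hx : x ≤ M.ξ) (ht : 0 ≤ t) (e : Clocks) :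
    |pathProfit M lam u x t e|
      ≤ (|M.r 0| + |M.r M.sbar|) * t + ∑ i ∈ Finset.range (M.ξ + 1), |M.c i| := by
  refine (abs_sub _ _).trans (add_le_add ?_ ?_)
  · have := intervalIntegral.norm_integral_le_of_norm_le_const (a := 0) (b := t)
      (f := fun k => M.r (productionRate M lam u x t e k)) (C := |M.r 0| + |M.r M.sbar|)
      fun k _ => abs_r_le hM (productionRate_mem k)
    rwa [sub_zero, abs_of_nonneg ht] at this
  · refine Finset.single_le_sum (f := fun i => |M.c i|) (fun _ _ => abs_nonneg _) ?_
    rw [Finset.mem_range]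
    exact Nat.lt_succ_of_le (level_le hx 0)

lemma integrable_pathProfit (hx : x ≤ M.ξ) (ht : 0 ≤ t) :
    Integrable (pathProfit M lam u x t) clockLaw :=
  Integrable.of_bound (measurable_pathProfit hM hlam u x t ht).aestronglyMeasurable _
    (.of_forall (abs_pathProfit_le hM u x t hx ht))

end Measurability

section Recursion

variable {M : Model} (hM : M.Assumptions) {lam : ℝ} (hlam : 0 ≤ lam) (u : Policy M) {x : ℕ}
  {t : ℝ}

lemma max_nextEpoch_mem_Icc (a : ℝ → ℝ) (y : ℝ) (ht : 0 ≤ t) :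
    max (nextEpoch a y t) 0 ∈ Icc 0 t := by
  refine ⟨le_max_right _ _, max_le ?_ ht⟩
  rcases nextEpoch_eq_neg_one_or_mem_Icc a y t with h | h
  · linarith
  · exact h.2

include hM

lemma intervalIntegrable_r_productionRate (hlam : 0 ≤ lam) (e : Clocks) (p q : ℝ) :
    IntervalIntegrable (fun k => M.r (productionRate M lam u x t e k)) volume p q :=
  intervalIntegrable_of_abs_le
    (measurable_comp_of_continuousOn hM.sbar_pos.le hM.r_cont
      ((measurable_productionRate hM hlam u x t).comp measurable_prodMk_left)
      fun _ => productionRate_mem _)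
    (fun _ => abs_r_le hM (productionRate_mem _)) p q

include hlam

/-- Decomposition of the profit on a sample path at the first epoch. -/
lemma pathProfit_update (hx : x < M.ξ) (ht : 0 ≤ t) (y : ℝ) (e : Clocks) :
    pathProfit M lam u x t (Function.update e x y)
      = (∫ k in max (nextEpoch (firstIntensity M lam u x) y t) 0..t,
          M.r (u.rate x 0 Fin.elim0 k))
        + if 0 ≤ nextEpoch (firstIntensity M lam u x) y t then
            pathProfit M lam (u.shift (nextEpoch (firstIntensity M lam u x) y t)) (x + 1)
              (nextEpoch (firstIntensity M lam u x) y t) e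
          else -M.c x := by
  set e' := Function.update e x y with he'
  obtain ⟨τ, hτ⟩ : ∃ τ, nextEpoch (firstIntensity M lam u x) y t = τ := ⟨_, rfl⟩
  have hτ' : nextEpoch (firstIntensity M lam u x) (e' x) t = τ := by simp [he', hτ]
  have hmem := max_nextEpoch_mem_Icc (firstIntensity M lam u x) y ht
  rw [hτ] at hmem ⊢
  have hii := intervalIntegrable_r_productionRate (x := x) (t := t) hM u hlam e'
  have hfirst : ∫ k in max τ 0..t, M.r (productionRate M lam u x t e' k)
      = ∫ k in max τ 0..t, M.r (u.rate x 0 Fin.elim0 k) := by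
    rw [intervalIntegral.integral_of_le hmem.2, intervalIntegral.integral_of_le hmem.2]
    refine setIntegral_congr_fun measurableSet_Ioc fun k hk => ?_
    rw [productionRate_eq_first]
    rw [hτ']
    exact (le_max_left _ _).trans_lt hk.1
  rw [pathProfit, ← intervalIntegral.integral_add_adjacent_intervals (hii 0 (max τ 0))
    (hii (max τ 0) t), hfirst]
  split_ifs with h
  · have h1 : pathProfit M lam (u.shift τ) (x + 1) τ e
        = pathProfit M lam (u.shift τ) (x + 1) τ e' :=
      pathProfit_congr fun i hi => by rw [he', Function.update_of_ne (by omega)]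
    have h2 : ∫ k in 0..max τ 0, M.r (productionRate M lam u x t e' k)
        = ∫ k in 0..τ, M.r (productionRate M lam (u.shift τ) (x + 1) τ e' k) := by
      rw [max_eq_left h, intervalIntegral.integral_of_le h, intervalIntegral.integral_of_le h]
      refine setIntegral_congr_fun measurableSet_Ioc fun k hk => ?_
      rw [productionRate_eq_shift hτ' hx hk.2]
    rw [h1, pathProfit, h2, level_eq_shift hτ' hx h]
    ring
  · push Not at h
    rw [max_eq_right h.le, intervalIntegral.integral_same, level,
      numIncrements_eq_zero (hτ'.trans_lt h)]
    simp [sub_eq_add_neg]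

lemma profit_first_step (hx : x < M.ξ) (ht : 0 ≤ t) :
    Integrable (fun y => (∫ k in max (nextEpoch (firstIntensity M lam u x) y t) 0..t,
          M.r (u.rate x 0 Fin.elim0 k))
        + if 0 ≤ nextEpoch (firstIntensity M lam u x) y t then
            profit M lam (u.shift (nextEpoch (firstIntensity M lam u x) y t)) (x + 1)
              (nextEpoch (firstIntensity M lam u x) y t)
          else -M.c x) (expMeasure 1) ∧
    profit M lam u x t
      = ∫ y, ((∫ k in max (nextEpoch (firstIntensity M lam u x) y t) 0..t,
          M.r (u.rate x 0 Fin.elim0 k))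
        + if 0 ≤ nextEpoch (firstIntensity M lam u x) y t then
            profit M lam (u.shift (nextEpoch (firstIntensity M lam u x) y t)) (x + 1)
              (nextEpoch (firstIntensity M lam u x) y t)
          else -M.c x) ∂expMeasure 1 := by
  have hint := integrable_pathProfit hM hlam u x t hx.le ht
  rw [← map_update_clockLaw x] at hint
  have hint' := hint.comp_measurable (measurable_update_pair x)
  have hinner (y : ℝ) : ∫ e, pathProfit M lam u x t (Function.update e x y) ∂clockLaw
      = (∫ k in max (nextEpoch (firstIntensity M lam u x) y t) 0..t,
          M.r (u.rate x 0 Fin.elim0 k))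
        + if 0 ≤ nextEpoch (firstIntensity M lam u x) y t then
            profit M lam (u.shift (nextEpoch (firstIntensity M lam u x) y t)) (x + 1)
              (nextEpoch (firstIntensity M lam u x) y t)
          else -M.c x := by
    simp only [pathProfit_update hM hlam u hx ht y]
    split_ifs with h
    · rw [integral_add (integrable_const _)
        (integrable_pathProfit hM hlam _ _ _ (Nat.succ_le_of_lt hx) h)]
      simp only [integral_const, probReal_univ, one_smul]
      rfl
    · simp
  constructor
  · refine hint'.integral_prod_left.congr (.of_forall fun y => ?_)
    exact hinner y
  · have h1 : profit M lam u x t = ∫ e, pathProfit M lam u x t e ∂clockLaw := rfl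
    rw [h1, ← map_update_clockLaw x, integral_map (measurable_update_pair x).aemeasurable
      hint.aestronglyMeasurable]
    exact (integral_prod _ hint').trans (integral_congr_ae (.of_forall hinner))

omit hM hlam in
lemma profit_top (t : ℝ) : profit M lam u M.ξ t = M.r 0 * t - M.c M.ξ := by
  have hN (e : Clocks) (k : ℝ) : numIncrements M lam u M.ξ t e k = 0 := by
    simp [numIncrements]
  have hp (e : Clocks) (k : ℝ) : productionRate M lam u M.ξ t e k = 0 := by
    change (fun N => u.rate (M.ξ + N) N (epochs M lam u M.ξ t e N) k)
      (numIncrements M lam u M.ξ t e k) = _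
    rw [hN]
    exact u.off _ _ _
  simp [profit, hp, level, hN, mul_comm]

end Recursion

section Verification

variable {M : Model} (hM : M.Assumptions) {lam : ℝ} (hlam : 0 ≤ lam) {T : ℝ} {V : ℕ → ℝ → ℝ}
  (hV : IsValueFunction M lam T V) (u : Policy M) {x : ℕ} {t : ℝ}
include hM hlam

lemma integrable_comp_max_nextEpoch (ht : 0 ≤ t) {Ψ : ℝ → ℝ} (hΨ : Continuous Ψ) :
    Integrable (fun y => Ψ (max (nextEpoch (firstIntensity M lam u x) y t) 0))
      (expMeasure 1) := by
  obtain ⟨m, hm⟩ := isCompact_Icc.exists_bound_of_continuousOn (hΨ.continuousOn (s := Icc 0 t))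
  have hτ := measurable_nextEpoch_threshold (measurable_firstIntensity hM u x)
    (firstIntensity_nonneg hM hlam u x) (firstIntensity_le hM hlam u x) t
  exact Integrable.of_bound (hΨ.measurable.comp (hτ.max measurable_const)).aestronglyMeasurable m
    (.of_forall fun y => hm _ (max_nextEpoch_mem_Icc _ y ht))

lemma integrable_comp_nextEpoch (ht : 0 ≤ t) {Ψ : ℝ → ℝ} (hΨ : Continuous Ψ) :
    Integrable (fun y => if 0 ≤ nextEpoch (firstIntensity M lam u x) y t then
      Ψ (nextEpoch (firstIntensity M lam u x) y t) else 0) (expMeasure 1) := by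
  have hτ := measurable_nextEpoch_threshold (measurable_firstIntensity hM u x)
    (firstIntensity_nonneg hM hlam u x) (firstIntensity_le hM hlam u x) t
  refine ((integrable_comp_max_nextEpoch (x := x) hM hlam u ht hΨ).indicator
    (measurableSet_le measurable_const hτ :
      MeasurableSet {y | 0 ≤ nextEpoch (firstIntensity M lam u x) y t})).congr
    (.of_forall fun y => ?_)
  simp only [indicator, mem_ofPred_eq]
  split_ifs with h
  · rw [max_eq_left h]
  · rfl

/-- The loss rate of a production rate with respect to the optimality equation. -/
def lossRate (M : Model) (lam d s : ℝ) : ℝ := hamiltonian M lam d - netRate M lam d s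

omit hlam in
lemma lossRate_nonneg (d : ℝ) {s : ℝ} (hs : s ∈ Icc 0 M.sbar) : 0 ≤ lossRate M lam d s :=
  sub_nonneg.2 (netRate_le_hamiltonian hM lam d hs)

include hV

/-- Expected profit up to the first epoch, if the value function is collected there. -/
lemma integral_first_step (hx : x < M.ξ) (ht : t ∈ Icc 0 T) :
    Integrable (fun y => (∫ k in max (nextEpoch (firstIntensity M lam u x) y t) 0..t,
          M.r (u.rate x 0 Fin.elim0 k))
        + if 0 ≤ nextEpoch (firstIntensity M lam u x) y t then
            V (x + 1) (nextEpoch (firstIntensity M lam u x) y t)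
          else -M.c x) (expMeasure 1) ∧
    ∫ y, ((∫ k in max (nextEpoch (firstIntensity M lam u x) y t) 0..t,
          M.r (u.rate x 0 Fin.elim0 k))
        + if 0 ≤ nextEpoch (firstIntensity M lam u x) y t then
            V (x + 1) (nextEpoch (firstIntensity M lam u x) y t)
          else -M.c x) ∂expMeasure 1
      = V x t - ∫ y, (∫ k in max (nextEpoch (firstIntensity M lam u x) y t) 0..t,
          lossRate M lam (V x k - V (x + 1) k) (u.rate x 0 Fin.elim0 k)) ∂expMeasure 1 := by
  set a := firstIntensity M lam u x with ha
  have ham : Measurable a := measurable_firstIntensity hM u x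
  have ha0 : ∀ k, 0 ≤ a k := firstIntensity_nonneg hM hlam u x
  have haC : ∀ k, a k ≤ lam * M.f M.sbar := firstIntensity_le hM hlam u x
  set d : ℝ → ℝ := fun k => V x k - V (x + 1) k with hd
  have hdc : Continuous d := (hV.continuous x).sub (hV.continuous (x + 1))
  set r : ℝ → ℝ := fun k => M.r (u.rate x 0 Fin.elim0 k) with hr
  set ℓ : ℝ → ℝ := fun k => lossRate M lam (d k) (u.rate x 0 Fin.elim0 k) with hℓ
  have hri (p q : ℝ) : IntervalIntegrable r volume p q :=
    intervalIntegrable_of_abs_le (measurable_r_rate hM u x)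
      (fun _ => abs_r_le hM (u.rate_mem _ _ _ _)) p q
  have hadi (p q : ℝ) : IntervalIntegrable (fun k => a k * d k) volume p q :=
    (intervalIntegrable_intensity ham ha0 haC p q).mul_continuousOn hdc.continuousOn
  have hHc : Continuous fun k => hamiltonian M lam (d k) :=
    (lipschitzWith_hamiltonian hM hlam).continuous.comp hdc
  have hHi (p q : ℝ) : IntervalIntegrable (fun k => hamiltonian M lam (d k)) volume p q :=
    hHc.intervalIntegrable p q
  have hℓeq (k : ℝ) : ℓ k = hamiltonian M lam (d k) - r k + a k * d k := by
    simp only [hℓ, lossRate, netRate, hr, ha, firstIntensity]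
    ring
  have hℓi (p q : ℝ) : IntervalIntegrable ℓ volume p q := by
    rw [funext hℓeq]
    exact ((hHi p q).sub (hri p q)).add (hadi p q)
  have hprim {g : ℝ → ℝ} (hg : ∀ p q, IntervalIntegrable g volume p q) :
      Continuous fun p => ∫ k in p..t, g k := by
    simp only [fun p => intervalIntegral.integral_symm (f := g) (μ := volume) t p]
    exact (intervalIntegral.continuous_primitive hg t).neg
  have hpath (y : ℝ) : (∫ k in max (nextEpoch a y t) 0..t, r k)
        + (if 0 ≤ nextEpoch a y t then V (x + 1) (nextEpoch a y t) else -M.c x)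
      = (V x t - ∫ k in max (nextEpoch a y t) 0..t, ℓ k)
        + ((∫ k in max (nextEpoch a y t) 0..t, a k * d k)
          - if 0 ≤ nextEpoch a y t then d (nextEpoch a y t) else 0) := by
    have hmem := max_nextEpoch_mem_Icc a y ht.1
    set p := max (nextEpoch a y t) 0 with hp
    have hftc : ∫ k in p..t, hamiltonian M lam (d k) = V x t - V x p := by
      refine intervalIntegral.integral_eq_sub_of_hasDerivAt (fun k hk => ?_) (hHi p t)
      rw [uIcc_of_le hmem.2] at hk
      exact hV.hasDerivAt x hx k ⟨hmem.1.trans hk.1, hk.2.trans ht.2⟩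
    have hsum : ∫ k in p..t, ℓ k
        = (∫ k in p..t, hamiltonian M lam (d k)) - (∫ k in p..t, r k)
          + ∫ k in p..t, a k * d k := by
      simp only [hℓeq]
      rw [intervalIntegral.integral_add ((hHi p t).sub (hri p t)) (hadi p t),
        intervalIntegral.integral_sub (hHi p t) (hri p t)]
    rw [hsum, hftc]
    split_ifs with h
    · have : p = nextEpoch a y t := max_eq_left h
      rw [this, hd]
      ring
    · have : p = 0 := max_eq_right (not_le.1 h).le
      rw [this, hV.zero x hx.le]
      ring
  have hI1 := integrable_comp_max_nextEpoch (x := x) hM hlam u ht.1 (hprim hℓi)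
  have hI2 := integrable_comp_max_nextEpoch (x := x) hM hlam u ht.1 (hprim hadi)
  have hI3 := integrable_comp_nextEpoch (x := x) hM hlam u ht.1 hdc
  have hI4 := ((integrable_const (μ := expMeasure 1) (V x t)).sub hI1).add (hI2.sub hI3)
  refine ⟨hI4.congr (.of_forall fun y => (hpath y).symm), ?_⟩
  rw [integral_congr_ae (.of_forall hpath)]
  refine (integral_add ((integrable_const _).sub hI1) (hI2.sub hI3)).trans ?_
  rw [integral_sub' hI2 hI3, ← ha, integral_nextEpoch ham ha0 haC ht.1 hdc, sub_self, add_zero,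
    integral_sub' (integrable_const _) hI1, integral_const, probReal_univ, one_smul]

omit hM hlam in
lemma value_top (ht : t ∈ Icc 0 T) : V M.ξ t = M.r 0 * t - M.c M.ξ := by
  have h1 : ∫ _ in (0 : ℝ)..t, M.r 0 = V M.ξ t - V M.ξ 0 := by
    refine intervalIntegral.integral_eq_sub_of_hasDerivAt (fun k hk => ?_)
      intervalIntegrable_const
    rw [uIcc_of_le ht.1] at hk
    exact hV.hasDerivAt_top k ⟨hk.1, hk.2.trans ht.2⟩
  rw [hV.zero _ le_rfl, intervalIntegral.integral_const, smul_eq_mul] at h1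
  linarith

lemma profit_le_value (hx : x ≤ M.ξ) (ht : t ∈ Icc 0 T) : profit M lam u x t ≤ V x t := by
  obtain ⟨n, hn⟩ : ∃ n, x + n = M.ξ := ⟨M.ξ - x, by omega⟩
  induction n generalizing x t u with
  | zero =>
    obtain rfl : x = M.ξ := by omega
    rw [profit_top, value_top hV ht]
  | succ n ih =>
    have hx' : x < M.ξ := by omega
    obtain ⟨hi, heq⟩ := profit_first_step hM hlam u hx' ht.1
    obtain ⟨hi', heq'⟩ := integral_first_step hM hlam hV u hx' ht
    rw [heq]
    refine (integral_mono hi hi' fun y => ?_).trans ?_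
    · refine add_le_add le_rfl ?_
      split_ifs with h
      · have h1 := max_nextEpoch_mem_Icc (firstIntensity M lam u x) y ht.1
        rw [max_eq_left h] at h1
        exact ih _ hx' ⟨h1.1, h1.2.trans ht.2⟩ (by omega)
      · exact le_rfl
    · rw [heq']
      refine sub_le_self _ (integral_nonneg fun y => ?_)
      exact intervalIntegral.integral_nonneg (max_nextEpoch_mem_Icc _ y ht.1).2
        fun k _ => lossRate_nonneg hM _ (u.rate_mem _ _ _ _)

/-- The feedback policy that maximizes the net revenue rate. -/
def optPolicy : Policy M where
  rate y _ _ k := if y < M.ξ then optRate M lam (V y k - V (y + 1) k) else 0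
  measurable_rate y n := by
    by_cases h : y < M.ξ
    · simp only [h, if_true]
      exact (antitone_optRate hM hlam).measurable.comp
        (((hV.continuous y).sub (hV.continuous (y + 1))).measurable.comp measurable_snd)
    · simp only [h, if_false]
      exact measurable_const
  rate_mem y n h k := by
    split_ifs
    · exact optRate_mem hM lam _
    · exact hM.zero_mem
  off n h k := by simp

lemma profit_optPolicy (hx : x ≤ M.ξ) (ht : t ∈ Icc 0 T) :
    profit M lam (optPolicy hM hlam hV) x t = V x t := by
  obtain ⟨n, hn⟩ : ∃ n, x + n = M.ξ := ⟨M.ξ - x, by omega⟩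
  set u := optPolicy hM hlam hV with hu
  have hshift (τ : ℝ) : u.shift τ = u := rfl
  induction n generalizing x t with
  | zero =>
    obtain rfl : x = M.ξ := by omega
    rw [profit_top, value_top hV ht]
  | succ n ih =>
    have hx' : x < M.ξ := by omega
    have hloss (k : ℝ) :
        lossRate M lam (V x k - V (x + 1) k) (u.rate x 0 Fin.elim0 k) = 0 := by
      simp [hu, optPolicy, hx', lossRate, hamiltonian]
    have heq' := (integral_first_step hM hlam hV u hx' ht).2
    simp only [hloss, intervalIntegral.integral_zero, integral_zero, sub_zero] at heq'
    rw [(profit_first_step hM hlam u hx' ht.1).2, ← heq']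
    refine integral_congr_ae (.of_forall fun y => ?_)
    simp only [hshift]
    congr 1
    split_ifs with h
    · have h1 := max_nextEpoch_mem_Icc (firstIntensity M lam u x) y ht.1
      rw [max_eq_left h] at h1
      exact ih hx' ⟨h1.1, h1.2.trans ht.2⟩ (by omega)
    · rfl

lemma optimalProfit_eq_value (hx : x ≤ M.ξ) (ht : t ∈ Icc 0 T) :
    optimalProfit M lam x t = V x t := by
  have : Nonempty (Policy M) := ⟨optPolicy hM hlam hV⟩
  refine le_antisymm (ciSup_le fun u => profit_le_value hM hlam hV u hx ht) ?_
  rw [← profit_optPolicy hM hlam hV hx ht]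
  exact le_ciSup (f := fun u => profit M lam u x t)
    ⟨V x t, by rintro _ ⟨u, rfl⟩; exact profit_le_value hM hlam hV u hx ht⟩ _

end Verification

end CBP

end

theorem proposition1 (M : CBP.Model) (hM : M.Assumptions) (lam : ℝ) (hlam : 0 ≤ lam)
    (t : ℝ) (ht : 0 ≤ t) :
    CBP.ConcaveOnLevels M.ξ (fun x => CBP.optimalProfit M lam x t) := by
  obtain ⟨V, hV⟩ := CBP.exists_isValueFunction hM hlam ht
  have htT : t ∈ Set.Icc 0 t := ⟨ht, le_rfl⟩
  intro x hx
  have hconc := hV.concave hM hlam htT x hx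
  simp only at hconc ⊢
  rwa [CBP.optimalProfit_eq_value hM hlam hV (by omega) htT,
    CBP.optimalProfit_eq_value hM hlam hV (by omega) htT,
    CBP.optimalProfit_eq_value hM hlam hV (by omega) htT]
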